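/- For $(x,y,z,w)\in\mathbb{R}^4$ consider the matrix $$\tilde P=\begin{bmatrix}1&0&0&1&x&y\\0&1&0&-1&-z&-w\\0&0&1&1&1&1\end{bmatrix},$$ let $p_{ijk}$ ($1\le i<j<k\le 6$) be its maximal minors, formed by the columns $i,j,k$, and let $q=p_{134}\,p_{156}\,p_{235}\,p_{246}-p_{135}\,p_{146}\,p_{234}\,p_{256}$, which vanishes precisely when the six columns, viewed as points of $\mathbb{P}^2$, lie on a conic. Let $\mathcal{Y}(3,6)_{\mathbb{R}}\subset\mathbb{R}^4$ be the set of all $(x,y,z,w)$ such that all $20$ minors $p_{ijk}$ are nonzero and $q\neq 0$, with the topology induced from $\mathbb{R}^4$. This is the open real moduli space of six labeled points in general position in the projective plane (no three on a line, not all six on a conic). Then $\mathcal{Y}(3,6)_{\mathbb{R}}$ has exactly $432$ connected components. -/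

import Mathlib

/-- The maximal minor `p_{ijk}` of a `3 × 6` matrix: the determinant of its columns `i, j, k`.
Columns are numbered `0, …, 5`. -/
def minor36 {K : Type*} [CommRing K] (P : Matrix (Fin 3) (Fin 6) K) (i j k : Fin 6) : K :=
  (P.submatrix id ![i, j, k]).det

/-- The coconic polynomial
`q = p₁₃₄ p₁₅₆ p₂₃₅ p₂₄₆ - p₁₃₅ p₁₄₆ p₂₃₄ p₂₅₆` (columns numbered from `1` in this formula).
It vanishes if and only if the six columns, as points of the plane, lie on a conic. -/
def coconic36 {K : Type*} [CommRing K] (P : Matrix (Fin 3) (Fin 6) K) : K :=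
  minor36 P 0 2 3 * minor36 P 0 4 5 * minor36 P 1 2 4 * minor36 P 1 3 5
    - minor36 P 0 2 4 * minor36 P 0 3 5 * minor36 P 1 2 3 * minor36 P 1 4 5

/-- The columns of `P` are six points of the projective plane in general position:
all `20` maximal minors are nonzero (no three points on a line), and the coconic polynomial is
nonzero (the six points are not on a conic). -/
def InGeneralPosition36 {K : Type*} [CommRing K] (P : Matrix (Fin 3) (Fin 6) K) : Prop :=
  (∀ i j k : Fin 6, i < j → j < k → minor36 P i j k ≠ 0) ∧ coconic36 P ≠ 0

/-- The normalized `3 × 6` matrix with parameters `(x, y, z, w) = (p 0, p 1, p 2, p 3)`. Over a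
field, each `GL₃ × torus` orbit of matrices in general position has exactly one such member. -/
def sixPoints {K : Type*} [CommRing K] (p : Fin 4 → K) : Matrix (Fin 3) (Fin 6) K :=
  !![1, 0, 0, 1, p 0, p 1;
     0, 1, 0, -1, -p 2, -p 3;
     0, 0, 1, 1, 1, 1]

/-- The points over `K` of the moduli space `Y(3,6)` of six labeled points in general position in
the projective plane, as the set of parameters `(x, y, z, w)` of the normalized matrices in
general position. The real moduli space is `moduliY36 ℝ`, an open subset of `ℝ⁴`. -/
def moduliY36 (K : Type*) [CommRing K] : Set (Fin 4 → K) :=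
  {p | InGeneralPosition36 (sixPoints p)}

open Set

/-! The space is the complement of fifteen walls in ℝ⁴, and the signs of the walls are locally
constant on it. So it suffices to count the sign vectors that occur and to show that each one cuts
out a connected region.

Upper bound: each relation `a + b + c = 0` between monomials in the walls forbids the three terms to
have equal signs. A short list of such relations leaves 432 sign vectors (`validSigns`).

Lower bound: the adjacent transpositions of the six labels and a Cremona map act by homeomorphisms
(they are the standard generators of the Weyl group of E₆). They carry walls to signed Laurent
monomials in the walls, hence permute sign regions. One base region is visibly connected, and its
orbit has 432 sign vectors (`orbitCodes`). As the two numbers agree, these are all the nonempty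
regions, and each is connected. -/

/-! ### The walls. -/

/-- The fifteen nonconstant factors whose nonvanishing defines `moduliY36 ℝ`. -/
def walls (p : Fin 4 → ℝ) : Fin 15 → ℝ :=
  ![p 0, p 1, p 2, p 3, 1 - p 0, 1 - p 1, 1 - p 2, 1 - p 3,
    p 0 - p 2, p 1 - p 3, p 0 - p 1, p 2 - p 3,
    p 0 * p 3 - p 1 * p 2,
    (1 - p 0) * (1 - p 3) - (1 - p 1) * (1 - p 2),
    p 1 * p 2 * (1 - p 0) * (1 - p 3) - p 0 * p 3 * (1 - p 1) * (1 - p 2)]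

theorem forall_fin15 {P : Fin 15 → Prop} :
    (∀ k, P k) ↔ P 0 ∧ P 1 ∧ P 2 ∧ P 3 ∧ P 4 ∧ P 5 ∧ P 6 ∧ P 7 ∧ P 8 ∧ P 9 ∧ P 10 ∧ P 11 ∧
      P 12 ∧ P 13 ∧ P 14 := by
  constructor
  · intro h
    exact ⟨h 0, h 1, h 2, h 3, h 4, h 5, h 6, h 7, h 8, h 9, h 10, h 11, h 12, h 13, h 14⟩
  · rintro ⟨h0, h1, h2, h3, h4, h5, h6, h7, h8, h9, h10, h11, h12, h13, h14⟩ k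
    fin_cases k <;> assumption

/-- Six of the twenty minors are constantly 1 or -1. The other fourteen are walls 0 to 13 up to
sign, and wall 14 is the coconic polynomial. -/
theorem mem_moduliY36_iff (p : Fin 4 → ℝ) : p ∈ moduliY36 ℝ ↔ ∀ k, walls p k ≠ 0 := by
  have hq : coconic36 (sixPoints p) =
      p 1 * p 2 * (1 - p 0) * (1 - p 3) - p 0 * p 3 * (1 - p 1) * (1 - p 2) := by
    simp [coconic36, minor36, sixPoints, Matrix.det_fin_three]
    ring
  rw [forall_fin15]
  constructor
  · rintro ⟨h, hc⟩
    rw [hq] at hc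
    have m (i j k : Fin 6) (hij : i < j) (hjk : j < k) (a : ℝ)
        (ha : a = 0 → minor36 (sixPoints p) i j k = 0) : a ≠ 0 :=
      fun h0 => h i j k hij hjk (ha h0)
    refine ⟨m 1 2 4 ?_ ?_ _ ?_, m 1 2 5 ?_ ?_ _ ?_, m 0 2 4 ?_ ?_ _ ?_, m 0 2 5 ?_ ?_ _ ?_,
      m 1 3 4 ?_ ?_ _ ?_, m 1 3 5 ?_ ?_ _ ?_, m 0 3 4 ?_ ?_ _ ?_, m 0 3 5 ?_ ?_ _ ?_,
      m 2 3 4 ?_ ?_ _ ?_, m 2 3 5 ?_ ?_ _ ?_, m 1 4 5 ?_ ?_ _ ?_, m 0 4 5 ?_ ?_ _ ?_,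
      m 2 4 5 ?_ ?_ _ ?_, m 3 4 5 ?_ ?_ _ ?_, hc⟩ <;>
    first
    | decide
    | (intro h0
       simp [walls] at h0
       simp [minor36, sixPoints, Matrix.det_fin_three]
       linarith)
  · rintro ⟨h0, h1, h2, h3, h4, h5, h6, h7, h8, h9, h10, h11, h12, h13, h14⟩
    refine ⟨?_, by rw [hq]; exact h14⟩
    intro i j k hij hjk hm
    fin_cases i <;> fin_cases j <;> first | (exact absurd hij (by decide)) | skip
    all_goals fin_cases k <;> first | (exact absurd hjk (by decide)) | skip
    all_goals
      simp [minor36, sixPoints, Matrix.det_fin_three] at hm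
    all_goals
      first
      | exact h0 (by simp [walls]; linarith)
      | exact h1 (by simp [walls]; linarith)
      | exact h2 (by simp [walls]; linarith)
      | exact h3 (by simp [walls]; linarith)
      | exact h4 (by simp [walls]; linarith)
      | exact h5 (by simp [walls]; linarith)
      | exact h6 (by simp [walls]; linarith)
      | exact h7 (by simp [walls]; linarith)
      | exact h8 (by simp [walls]; linarith)
      | exact h9 (by simp [walls]; linarith)
      | exact h10 (by simp [walls]; linarith)
      | exact h11 (by simp [walls]; linarith)
      | exact h12 (by simp [walls]; linarith)
      | exact h13 (by simp [walls]; linarith)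

/-! ### Finite computations with sign vectors. -/

/-- The three Booleans are not all equal. -/
def notAllEq (a b c : Bool) : Bool := !(a == b && b == c)

/-- Depth-first search along `next`, listing the visited numbers; the bits of `seen` record which
numbers have already been visited. -/
def explore (next : ℕ → List ℕ) : ℕ → List ℕ → ℕ → List ℕ → List ℕ
  | 0, _, _, visited => visited
  | _ + 1, [], _, visited => visited
  | fuel + 1, a :: stack, seen, visited =>
    bif seen.testBit a then explore next fuel stack seen visited
    else explore next fuel (next a ++ stack) (seen ||| 2 ^ a) (a :: visited)

/-- The two choices for a bit, restricted by a condition. -/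
def branch {α : Type*} (c : Bool → Bool) (f : Bool → List α) : List α :=
  (bif c false then f false else []) ++ (bif c true then f true else [])

theorem mem_branch {α : Type*} {c : Bool → Bool} {f : Bool → List α} {a : α} (b : Bool)
    (hc : c b = true) (ha : a ∈ f b) : a ∈ branch c f := by
  cases b <;> simp [branch, hc, ha]

/-- The effect of `p ↦ 1 - p`, which exchanges the points `3` and `4`, on sign vectors. -/
def swap34Bits (s : Fin 15 → Bool) : Fin 15 → Bool :=
  ![s 4, s 5, s 6, s 7, s 0, s 1, s 2, s 3, !s 8, !s 9, !s 10, !s 11, s 13, s 12, !s 14]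

def swap12Bits (s : Fin 15 → Bool) : Fin 15 → Bool :=
  ![s 2, s 3, s 0, s 1, s 6, s 7, s 4, s 5, !s 8, !s 9, s 11, s 10, !s 12, !s 13, !s 14]

def swap56Bits (s : Fin 15 → Bool) : Fin 15 → Bool :=
  ![s 1, s 0, s 3, s 2, s 5, s 4, s 7, s 6, s 9, s 8, !s 10, !s 11, !s 12, !s 13, !s 14]

/-- The bit `true` stands for a negative wall, so products and quotients become xor. The last two
entries trade the collinearity of points 4, 5, 6 for the conic condition. -/
def cremonaBits (s : Fin 15 → Bool) : Fin 15 → Bool :=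
  ![s 0, s 1, s 2, s 3, !(s 4 ^^ s 0), !(s 5 ^^ s 1), !(s 6 ^^ s 2), !(s 7 ^^ s 3),
    !(s 8 ^^ (s 0 ^^ s 2)), !(s 9 ^^ (s 1 ^^ s 3)), !(s 10 ^^ (s 0 ^^ s 1)),
    !(s 11 ^^ (s 2 ^^ s 3)), !(s 12 ^^ (s 0 ^^ s 1 ^^ s 2 ^^ s 3)),
    s 14 ^^ (s 0 ^^ s 1 ^^ s 2 ^^ s 3), s 13 ^^ (s 0 ^^ s 1 ^^ s 2 ^^ s 3)]

def swap45Bits (s : Fin 15 → Bool) : Fin 15 → Bool :=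
  ![s 0, s 1 ^^ s 0, s 2, s 3 ^^ s 2, !(s 4 ^^ s 0), s 10 ^^ s 0, !(s 6 ^^ s 2), s 11 ^^ s 2,
    !(s 8 ^^ (s 0 ^^ s 2)), !(s 12 ^^ (s 0 ^^ s 2)), s 5 ^^ s 0, s 7 ^^ s 2,
    !(s 9 ^^ (s 0 ^^ s 2)), !(s 13 ^^ (s 0 ^^ s 2)), !s 14]

def swap23Bits (s : Fin 15 → Bool) : Fin 15 → Bool :=
  ![s 0 ^^ s 2, s 1 ^^ s 3, s 2, s 3, !(s 8 ^^ s 2), !(s 9 ^^ s 3), !(s 6 ^^ s 2),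
    !(s 7 ^^ s 3), !(s 4 ^^ s 2), !(s 5 ^^ s 3), s 12 ^^ (s 2 ^^ s 3), !(s 11 ^^ (s 2 ^^ s 3)),
    s 10 ^^ (s 2 ^^ s 3), !(s 13 ^^ (s 2 ^^ s 3)), !s 14]

/-- The action on codes (numbers with 15 binary digits) induced by a map of sign vectors. -/
def onCodes (f : (Fin 15 → Bool) → Fin 15 → Bool) (n : ℕ) : ℕ :=
  Nat.ofBits (f fun k => n.testBit k)

def neighbours (n : ℕ) : List ℕ :=
  [onCodes swap34Bits n, onCodes swap12Bits n, onCodes swap56Bits n, onCodes cremonaBits n,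
    onCodes swap45Bits n, onCodes swap23Bits n]

/-- The sign vector of the base chamber. -/
def baseSigns : Fin 15 → Bool :=
  ![false, false, false, false, true, true, true, true, true, true, true, true, false, true, true]

/-- A search finding 432 codes pushes 1 + 6 · 432 = 2593 entries, so the fuel suffices. Too little
fuel could only lose codes. -/
def orbitCodes : List ℕ := explore neighbours 2600 [Nat.ofBits baseSigns] 0 []

/-- The sign vectors that satisfy the sign conditions imposed by three-term relations. -/
def validSigns : List (Fin 15 → Bool) :=
  branch (fun _ => true) fun s0 =>
  branch (fun _ => true) fun s1 =>
  branch (fun _ => true) fun s2 =>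
  branch (fun _ => true) fun s3 =>
  -- The constant `true` is the sign of -1 in `x + (1 - x) + (-1) = 0`.
  branch (fun s4 => notAllEq s0 s4 true) fun s4 =>
  branch (fun s5 => notAllEq s1 s5 true) fun s5 =>
  branch (fun s6 => notAllEq s2 s6 true) fun s6 =>
  branch (fun s7 => notAllEq s3 s7 true) fun s7 =>
  branch (fun s8 => notAllEq s0 (!s2) (!s8) && notAllEq s6 (!s4) (!s8)) fun s8 =>
  branch (fun s9 => notAllEq s1 (!s3) (!s9) && notAllEq s7 (!s5) (!s9)) fun s9 =>
  branch (fun s10 => notAllEq s0 (!s1) (!s10) && notAllEq s5 (!s4) (!s10)) fun s10 =>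
  branch (fun s11 => notAllEq s2 (!s3) (!s11) && notAllEq s7 (!s6) (!s11)) fun s11 =>
  branch (fun s12 => notAllEq (s0 ^^ s3) (!(s1 ^^ s2)) (!s12) &&
    notAllEq (s2 ^^ s10) (!(s0 ^^ s11)) (!s12)) fun s12 =>
  branch (fun s13 => notAllEq (s4 ^^ s7) (!(s5 ^^ s6)) (!s13) &&
    notAllEq (s6 ^^ s9) (!(s7 ^^ s8)) (!s13) && notAllEq (s4 ^^ s11) (!(s6 ^^ s10)) (!s13) &&
    notAllEq (s4 ^^ s12) (s0 ^^ s13) (s8 ^^ s10)) fun s13 =>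
  branch (fun s14 => notAllEq (s6 ^^ s9 ^^ s10) (s1 ^^ s13) (!s14) &&
    notAllEq (s5 ^^ s12) (s2 ^^ s9 ^^ s10) s14 && notAllEq (s4 ^^ s12) (s3 ^^ s8 ^^ s10) s14 &&
    notAllEq (s7 ^^ s8 ^^ s10) (s0 ^^ s13) (!s14) &&
    notAllEq (s4 ^^ s9 ^^ s11) (s3 ^^ s13) (!s14)) fun s14 =>
  [![s0, s1, s2, s3, s4, s5, s6, s7, s8, s9, s10, s11, s12, s13, s14]]

theorem length_validSigns : validSigns.length = 432 := by
  decide +kernel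

theorem length_orbitCodes : orbitCodes.length = 432 := by
  decide +kernel

theorem nodup_explore (next : ℕ → List ℕ) (fuel : ℕ) (stack : List ℕ) (seen : ℕ)
    (visited : List ℕ) (hseen : ∀ a ∈ visited, seen.testBit a = true) (hv : visited.Nodup) :
    (explore next fuel stack seen visited).Nodup := by
  induction fuel generalizing stack seen visited with
  | zero => simpa [explore] using hv
  | succ fuel ih =>
    cases stack with
    | nil => simpa [explore] using hv
    | cons a stack =>
      rw [explore]
      cases h : seen.testBit a with
      | true => exact ih _ _ _ hseen hv
      | false =>
        refine ih _ _ _ ?_ (List.nodup_cons.2 ⟨fun ha => ?_, hv⟩)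
        · intro b hb
          rcases List.mem_cons.1 hb with rfl | hb
          · simp
          · simp [hseen b hb]
        · simp [hseen a ha] at h

theorem nodup_orbitCodes : orbitCodes.Nodup :=
  nodup_explore _ _ _ _ _ (by simp) List.nodup_nil

/-- Only this soundness of the search is needed; that it exhausts the orbit follows from the count.
-/
theorem explore_induction (next : ℕ → List ℕ) (P : ℕ → Prop)
    (hnext : ∀ a, P a → ∀ b ∈ next a, P b) (fuel : ℕ) (stack : List ℕ) (seen : ℕ)
    (visited : List ℕ) (hs : ∀ a ∈ stack, P a) (hv : ∀ a ∈ visited, P a) :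
    ∀ a ∈ explore next fuel stack seen visited, P a := by
  induction fuel generalizing stack seen visited with
  | zero => simpa [explore] using hv
  | succ fuel ih =>
    cases stack with
    | nil => simpa [explore] using hv
    | cons a stack =>
      rw [explore]
      have hs' := List.forall_mem_cons.1 hs
      cases h : seen.testBit a with
      | true => exact ih _ _ _ hs'.2 hv
      | false =>
        refine ih _ _ _ ?_ (List.forall_mem_cons.2 ⟨hs'.1, hv⟩)
        intro b hb
        rcases List.mem_append.1 hb with hb | hb
        · exact hnext a hs'.1 b hb
        · exact hs'.2 b hb

/-! ### Signs and symmetries of the moduli space. -/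

/-- Whether a real number is negative. -/
noncomputable def negBit (a : ℝ) : Bool := decide (a < 0)

theorem negBit_eq_true {a : ℝ} : negBit a = true ↔ a < 0 := by simp [negBit]

theorem negBit_eq_false {a : ℝ} : negBit a = false ↔ 0 ≤ a := by simp [negBit]

theorem negBit_neg {a : ℝ} (ha : a ≠ 0) : negBit (-a) = !negBit a := by
  rcases lt_or_gt_of_ne ha with h | h <;> simp [negBit, h, h.not_gt]

theorem negBit_inv (a : ℝ) : negBit a⁻¹ = negBit a := by
  simp [negBit]

theorem negBit_mul {a b : ℝ} (ha : a ≠ 0) (hb : b ≠ 0) :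
    negBit (a * b) = (negBit a ^^ negBit b) := by
  rcases lt_or_gt_of_ne ha with h | h <;> rcases lt_or_gt_of_ne hb with h' | h' <;>
    simp [negBit, mul_neg_iff, h, h', h.not_gt, h'.not_gt]

theorem negBit_div {a b : ℝ} (ha : a ≠ 0) (hb : b ≠ 0) :
    negBit (a / b) = (negBit a ^^ negBit b) := by
  rw [div_eq_mul_inv, negBit_mul ha (inv_ne_zero hb), negBit_inv]

theorem notAllEq_negBit {a b c : ℝ} (ha : a ≠ 0) (h : a + b + c = 0) :
    notAllEq (negBit a) (negBit b) (negBit c) = true := by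
  rcases lt_or_gt_of_ne ha with h0 | h0 <;> by_cases hb : b < 0 <;> by_cases hc : c < 0 <;>
    simp [notAllEq, negBit, h0, h0.not_gt, hb, hc] <;> linarith

/-- The sign vector of the fifteen walls. -/
noncomputable def signs (p : Fin 4 → ℝ) (k : Fin 15) : Bool := negBit (walls p k)

/-- The set of points of the moduli space with a given sign vector. -/
def signRegion (s : Fin 15 → Bool) : Set (Fin 4 → ℝ) := {p | p ∈ moduliY36 ℝ ∧ signs p = s}

/-- An involution of the moduli space that acts on sign vectors. -/
structure IsSignSymmetry (g : (Fin 4 → ℝ) → Fin 4 → ℝ) (γ : (Fin 15 → Bool) → Fin 15 → Bool) :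
    Prop where
  continuousOn : ContinuousOn g (moduliY36 ℝ)
  mapsTo : MapsTo g (moduliY36 ℝ) (moduliY36 ℝ)
  apply_apply : ∀ p ∈ moduliY36 ℝ, g (g p) = p
  signs_apply : ∀ p ∈ moduliY36 ℝ, signs (g p) = γ (signs p)
  bits_apply_apply : ∀ s, γ (γ s) = s

theorem IsSignSymmetry.isConnected {g γ} (h : IsSignSymmetry g γ) {s : Fin 15 → Bool}
    (hs : IsConnected (signRegion s)) : IsConnected (signRegion (γ s)) := by
  have : signRegion (γ s) = g '' signRegion s := by
    ext p
    constructor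
    · rintro ⟨hp, hps⟩
      refine ⟨g p, ⟨h.mapsTo hp, ?_⟩, h.apply_apply p hp⟩
      rw [h.signs_apply p hp, hps, h.bits_apply_apply]
    · rintro ⟨q, ⟨hq, rfl⟩, rfl⟩
      exact ⟨h.mapsTo hq, h.signs_apply q hq⟩
  rw [this]
  exact hs.image g (h.continuousOn.mono fun p hp => hp.1)

def swap34 (p : Fin 4 → ℝ) : Fin 4 → ℝ := ![1 - p 0, 1 - p 1, 1 - p 2, 1 - p 3]

def swap12 (p : Fin 4 → ℝ) : Fin 4 → ℝ := ![p 2, p 3, p 0, p 1]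

def swap56 (p : Fin 4 → ℝ) : Fin 4 → ℝ := ![p 1, p 0, p 3, p 2]

noncomputable def cremona (p : Fin 4 → ℝ) : Fin 4 → ℝ := ![(p 0)⁻¹, (p 1)⁻¹, (p 2)⁻¹, (p 3)⁻¹]

noncomputable def swap45 (p : Fin 4 → ℝ) : Fin 4 → ℝ :=
  ![(p 0)⁻¹, p 1 / p 0, (p 2)⁻¹, p 3 / p 2]

noncomputable def swap23 (p : Fin 4 → ℝ) : Fin 4 → ℝ :=
  ![p 0 / p 2, p 1 / p 3, (p 2)⁻¹, (p 3)⁻¹]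

theorem coord_ne_zero {p : Fin 4 → ℝ} (hp : p ∈ moduliY36 ℝ) (i : Fin 4) : p i ≠ 0 := by
  have h := forall_fin15.1 ((mem_moduliY36_iff p).1 hp)
  fin_cases i
  exacts [h.1, h.2.1, h.2.2.1, h.2.2.2.1]

theorem continuousOn_coord (s : Set (Fin 4 → ℝ)) (i : Fin 4) :
    ContinuousOn (fun p : Fin 4 → ℝ => p i) s := (continuous_apply i).continuousOn

/-- Continuity on the moduli space of a map given by its four coordinates. -/
theorem continuousOn_vec4 {a b c d : (Fin 4 → ℝ) → ℝ} {s : Set (Fin 4 → ℝ)}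
    (ha : ContinuousOn a s) (hb : ContinuousOn b s) (hc : ContinuousOn c s)
    (hd : ContinuousOn d s) : ContinuousOn (fun p => ![a p, b p, c p, d p]) s := by
  refine continuousOn_pi.2 fun i => ?_
  fin_cases i <;> assumption

theorem vec4_eta (p : Fin 4 → ℝ) : ![p 0, p 1, p 2, p 3] = p := by
  ext i; fin_cases i <;> rfl

/-- Reduces the sign behaviour of a symmetry to an expression of the transformed walls as signed
monomials in the walls. -/
theorem isSignSymmetry_of_walls {g : (Fin 4 → ℝ) → Fin 4 → ℝ}
    {γ : (Fin 15 → Bool) → Fin 15 → Bool} (m : (Fin 15 → ℝ) → Fin 15 → ℝ)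
    (hg : ContinuousOn g (moduliY36 ℝ)) (hgg : ∀ p ∈ moduliY36 ℝ, g (g p) = p)
    (hm : ∀ p ∈ moduliY36 ℝ, ∀ k, walls (g p) k = m (walls p) k)
    (hsign : ∀ a : Fin 15 → ℝ, (∀ k, a k ≠ 0) →
      ∀ k, m a k ≠ 0 ∧ negBit (m a k) = γ (fun l => negBit (a l)) k)
    (hγ : ∀ s k, γ (γ s) k = s k) : IsSignSymmetry g γ where
  continuousOn := hg
  mapsTo p hp := (mem_moduliY36_iff _).2 fun k => by
    rw [hm p hp]; exact (hsign _ ((mem_moduliY36_iff p).1 hp) k).1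
  apply_apply := hgg
  signs_apply p hp := funext fun k => by
    rw [signs, hm p hp]; exact (hsign _ ((mem_moduliY36_iff p).1 hp) k).2
  bits_apply_apply s := funext (hγ s)

theorem isSignSymmetry_swap34 : IsSignSymmetry swap34 swap34Bits := by
  refine isSignSymmetry_of_walls (fun a => ![a 4, a 5, a 6, a 7, a 0, a 1, a 2, a 3, -a 8, -a 9,
    -a 10, -a 11, a 13, a 12, -a 14]) ?_ ?_ ?_ ?_ ?_
  · unfold swap34; apply continuousOn_vec4 <;> fun_prop
  · intro p _; simp [swap34, vec4_eta]
  · intro p _; rw [forall_fin15]; simp [swap34, walls]; ring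
  · intro a ha; rw [forall_fin15]; simp [ha, swap34Bits, negBit_neg]
  · intro s; rw [forall_fin15]; simp [swap34Bits]

theorem isSignSymmetry_swap12 : IsSignSymmetry swap12 swap12Bits := by
  refine isSignSymmetry_of_walls (fun a => ![a 2, a 3, a 0, a 1, a 6, a 7, a 4, a 5, -a 8, -a 9,
    a 11, a 10, -a 12, -a 13, -a 14]) ?_ ?_ ?_ ?_ ?_
  · unfold swap12; apply continuousOn_vec4 <;> fun_prop
  · intro p _; simp [swap12, vec4_eta]
  · intro p _; rw [forall_fin15]; simp [swap12, walls]; constructorm* _ ∧ _ <;> ring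
  · intro a ha; rw [forall_fin15]; simp [ha, swap12Bits, negBit_neg]
  · intro s; rw [forall_fin15]; simp [swap12Bits]

theorem isSignSymmetry_swap56 : IsSignSymmetry swap56 swap56Bits := by
  refine isSignSymmetry_of_walls (fun a => ![a 1, a 0, a 3, a 2, a 5, a 4, a 7, a 6, a 9, a 8,
    -a 10, -a 11, -a 12, -a 13, -a 14]) ?_ ?_ ?_ ?_ ?_
  · unfold swap56; apply continuousOn_vec4 <;> fun_prop
  · intro p _; simp [swap56, vec4_eta]
  · intro p _; rw [forall_fin15]; simp [swap56, walls]
  · intro a ha; rw [forall_fin15]; simp [ha, swap56Bits, negBit_neg]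
  · intro s; rw [forall_fin15]; simp [swap56Bits]

theorem isSignSymmetry_cremona : IsSignSymmetry cremona cremonaBits := by
  refine isSignSymmetry_of_walls (fun a => ![(a 0)⁻¹, (a 1)⁻¹, (a 2)⁻¹, (a 3)⁻¹, -(a 4 / a 0),
    -(a 5 / a 1), -(a 6 / a 2), -(a 7 / a 3), -(a 8 / (a 0 * a 2)), -(a 9 / (a 1 * a 3)),
    -(a 10 / (a 0 * a 1)), -(a 11 / (a 2 * a 3)), -(a 12 / (a 0 * a 1 * a 2 * a 3)),
    a 14 / (a 0 * a 1 * a 2 * a 3), a 13 / (a 0 * a 1 * a 2 * a 3)]) ?_ ?_ ?_ ?_ ?_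
  · unfold cremona
    apply continuousOn_vec4 <;>
      exact (continuousOn_coord _ _).inv₀ fun p hp => coord_ne_zero hp _
  · intro p _; simp [cremona, vec4_eta]
  · intro p hp
    have := coord_ne_zero hp
    have h0 := this 0; have h1 := this 1; have h2 := this 2; have h3 := this 3
    rw [forall_fin15]; simp [cremona, walls]
    constructorm* _ ∧ _ <;> field_simp <;> ring
  · intro a ha; rw [forall_fin15]
    simp [ha, cremonaBits, negBit_neg, negBit_mul, negBit_div, negBit_inv]
  · intro s; rw [forall_fin15]; simp [cremonaBits]

theorem isSignSymmetry_swap45 : IsSignSymmetry swap45 swap45Bits := by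
  refine isSignSymmetry_of_walls (fun a => ![(a 0)⁻¹, a 1 / a 0, (a 2)⁻¹, a 3 / a 2, -(a 4 / a 0),
    a 10 / a 0, -(a 6 / a 2), a 11 / a 2, -(a 8 / (a 0 * a 2)), -(a 12 / (a 0 * a 2)), a 5 / a 0,
    a 7 / a 2, -(a 9 / (a 0 * a 2)), -(a 13 / (a 0 * a 2)),
    -(a 14 / ((a 0 * a 2) * (a 0 * a 2)))]) ?_ ?_ ?_ ?_ ?_
  · unfold swap45
    have hi (i : Fin 4) : ContinuousOn (fun p : Fin 4 → ℝ => (p i)⁻¹) (moduliY36 ℝ) :=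
      (continuousOn_coord _ _).inv₀ fun p hp => coord_ne_zero hp _
    exact continuousOn_vec4 (hi 0) ((continuousOn_coord _ 1).mul (hi 0)) (hi 2)
      ((continuousOn_coord _ 3).mul (hi 2))
  · intro p hp
    have := coord_ne_zero hp
    simp [swap45, this, vec4_eta]
  · intro p hp
    have := coord_ne_zero hp
    have h0 := this 0; have h1 := this 1; have h2 := this 2; have h3 := this 3
    rw [forall_fin15]; simp [swap45, walls]
    constructorm* _ ∧ _ <;> field_simp <;> ring
  · intro a ha; rw [forall_fin15]
    simp [ha, swap45Bits, negBit_neg, negBit_mul, negBit_div, negBit_inv]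
  · intro s; rw [forall_fin15]; simp [swap45Bits]

theorem isSignSymmetry_swap23 : IsSignSymmetry swap23 swap23Bits := by
  refine isSignSymmetry_of_walls (fun a => ![a 0 / a 2, a 1 / a 3, (a 2)⁻¹, (a 3)⁻¹, -(a 8 / a 2),
    -(a 9 / a 3), -(a 6 / a 2), -(a 7 / a 3), -(a 4 / a 2), -(a 5 / a 3), a 12 / (a 2 * a 3),
    -(a 11 / (a 2 * a 3)), a 10 / (a 2 * a 3), -(a 13 / (a 2 * a 3)),
    -(a 14 / ((a 2 * a 3) * (a 2 * a 3)))]) ?_ ?_ ?_ ?_ ?_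
  · unfold swap23
    have hi (i : Fin 4) : ContinuousOn (fun p : Fin 4 → ℝ => (p i)⁻¹) (moduliY36 ℝ) :=
      (continuousOn_coord _ _).inv₀ fun p hp => coord_ne_zero hp _
    exact continuousOn_vec4 ((continuousOn_coord _ 0).mul (hi 2))
      ((continuousOn_coord _ 1).mul (hi 3)) (hi 2) (hi 3)
  · intro p hp
    have := coord_ne_zero hp
    simp [swap23, this, vec4_eta]
  · intro p hp
    have := coord_ne_zero hp
    have h0 := this 0; have h1 := this 1; have h2 := this 2; have h3 := this 3
    rw [forall_fin15]; simp [swap23, walls]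
    constructorm* _ ∧ _ <;> field_simp <;> ring
  · intro a ha; rw [forall_fin15]
    simp [ha, swap23Bits, negBit_neg, negBit_mul, negBit_div, negBit_inv]
  · intro s; rw [forall_fin15]; simp [swap23Bits]

/-! ### Three-term relations between the walls. -/

theorem signs_mem_validSigns {p : Fin 4 → ℝ} (hp : p ∈ moduliY36 ℝ) : signs p ∈ validSigns := by
  have ha := (mem_moduliY36_iff p).1 hp
  have clause {b₁ b₂ b₃ : Bool} {c₁ c₂ c₃ : ℝ} (h1 : negBit c₁ = b₁) (h2 : negBit c₂ = b₂)
      (h3 : negBit c₃ = b₃) (hc : c₁ ≠ 0) (h : c₁ + c₂ + c₃ = 0) :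
      notAllEq b₁ b₂ b₃ = true := by
    subst h1 h2 h3; exact notAllEq_negBit hc h
  have n (k : Fin 15) : negBit (-walls p k) = !signs p k := negBit_neg (ha k)
  have m (k l : Fin 15) : negBit (walls p k * walls p l) = (signs p k ^^ signs p l) :=
    negBit_mul (ha k) (ha l)
  have nm (k l : Fin 15) : negBit (-(walls p k * walls p l)) = !(signs p k ^^ signs p l) := by
    rw [negBit_neg (mul_ne_zero (ha k) (ha l)), m]
  have m3 (k l j : Fin 15) : negBit (walls p k * walls p l * walls p j) =
      (signs p k ^^ signs p l ^^ signs p j) := by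
    rw [negBit_mul (mul_ne_zero (ha k) (ha l)) (ha j), m, signs, signs, signs, Bool.xor_assoc]
  have one : negBit (-1) = true := by simp [negBit]
  have split (k l : Fin 15) (h : walls p k + walls p l = 1) :
      notAllEq (signs p k) (signs p l) true = true :=
    clause rfl rfl one (ha k) (by linarith)
  have diff (k l j : Fin 15) (h : walls p k - walls p l = walls p j) :
      notAllEq (signs p k) (!signs p l) (!signs p j) = true :=
    clause rfl (n l) (n j) (ha k) (by linarith)
  have det (k l i j t : Fin 15) (h : walls p k * walls p l - walls p i * walls p j = walls p t) :
      notAllEq (signs p k ^^ signs p l) (!(signs p i ^^ signs p j)) (!signs p t) = true :=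
    clause (m k l) (nm i j) (n t) (mul_ne_zero (ha k) (ha l)) (by linarith)
  have conicB (i j k l t : Fin 15)
      (h : walls p i * walls p j * walls p k + walls p l * walls p t = walls p 14) :
      notAllEq (signs p i ^^ signs p j ^^ signs p k) (signs p l ^^ signs p t) (!signs p 14) =
        true :=
    clause (m3 i j k) (m l t) (n 14) (mul_ne_zero (mul_ne_zero (ha i) (ha j)) (ha k))
      (by linarith)
  have conicA (l t i j k : Fin 15)
      (h : walls p l * walls p t + walls p i * walls p j * walls p k + walls p 14 = 0) :
      notAllEq (signs p l ^^ signs p t) (signs p i ^^ signs p j ^^ signs p k) (signs p 14) =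
        true :=
    clause (m l t) (m3 i j k) rfl (mul_ne_zero (ha l) (ha t)) h
  -- This is the Plücker relation for points 2, 3, 4, 6 seen from point 5.
  have mixed : notAllEq (signs p 4 ^^ signs p 12) (signs p 0 ^^ signs p 13)
      (signs p 8 ^^ signs p 10) = true :=
    clause (m 4 12) (m 0 13) (m 8 10) (mul_ne_zero (ha 4) (ha 12)) (by simp [walls]; ring)
  have heta : signs p = ![signs p 0, signs p 1, signs p 2, signs p 3, signs p 4, signs p 5,
      signs p 6, signs p 7, signs p 8, signs p 9, signs p 10, signs p 11, signs p 12,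
      signs p 13, signs p 14] := by
    refine funext (forall_fin15.2 ?_)
    simp
  rw [heta]
  refine mem_branch _ rfl <| mem_branch _ rfl <| mem_branch _ rfl <| mem_branch _ rfl <|
    mem_branch _ (split 0 4 ?_) <| mem_branch _ (split 1 5 ?_) <|
    mem_branch _ (split 2 6 ?_) <| mem_branch _ (split 3 7 ?_) <|
    mem_branch _ (Bool.and_eq_true_iff.2 ⟨diff 0 2 8 ?_, diff 6 4 8 ?_⟩) <|
    mem_branch _ (Bool.and_eq_true_iff.2 ⟨diff 1 3 9 ?_, diff 7 5 9 ?_⟩) <|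
    mem_branch _ (Bool.and_eq_true_iff.2 ⟨diff 0 1 10 ?_, diff 5 4 10 ?_⟩) <|
    mem_branch _ (Bool.and_eq_true_iff.2 ⟨diff 2 3 11 ?_, diff 7 6 11 ?_⟩) <|
    mem_branch _ (Bool.and_eq_true_iff.2 ⟨det 0 3 1 2 12 ?_, det 2 10 0 11 12 ?_⟩) <|
    mem_branch _ (Bool.and_eq_true_iff.2 ⟨Bool.and_eq_true_iff.2 ⟨Bool.and_eq_true_iff.2
      ⟨det 4 7 5 6 13 ?_, det 6 9 7 8 13 ?_⟩, det 4 11 6 10 13 ?_⟩, mixed⟩) <|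
    mem_branch _ (Bool.and_eq_true_iff.2 ⟨Bool.and_eq_true_iff.2 ⟨Bool.and_eq_true_iff.2
      ⟨Bool.and_eq_true_iff.2 ⟨conicB 6 9 10 1 13 ?_, conicA 5 12 2 9 10 ?_⟩,
      conicA 4 12 3 8 10 ?_⟩, conicB 7 8 10 0 13 ?_⟩, conicB 4 9 11 3 13 ?_⟩) <|
    List.mem_singleton.2 rfl
  all_goals simp [walls]
  all_goals ring

/-! ### The base chamber. -/

theorem mem_signRegion_baseSigns (p : Fin 4 → ℝ) : p ∈ signRegion baseSigns ↔
    1 < p 0 ∧ p 0 < p 1 ∧ p 0 < p 2 ∧ 0 < p 0 * p 3 - p 1 * p 2 ∧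
      (1 - p 0) * (1 - p 3) - (1 - p 1) * (1 - p 2) < 0 := by
  constructor
  · rintro ⟨hp, hs⟩
    have hw := (mem_moduliY36_iff p).1 hp
    have hneg (k : Fin 15) (hk : baseSigns k = true) : walls p k < 0 :=
      negBit_eq_true.1 ((congrFun hs k).trans hk)
    have hpos : 0 < walls p 12 :=
      lt_of_le_of_ne (negBit_eq_false.1 (congrFun hs 12)) (hw 12).symm
    refine ⟨sub_neg.1 (hneg 4 rfl), sub_neg.1 (hneg 10 rfl), sub_neg.1 (hneg 8 rfl), hpos,
      hneg 13 rfl⟩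
  · rintro ⟨h0, h1, h2, hA, hB⟩
    have hy3 : p 1 < p 3 := by nlinarith
    have hz3 : p 2 < p 3 := by nlinarith
    -- Wall 14 is the sum of the two products bounded in `e1` and `e2`.
    have hQ : p 1 * p 2 * (1 - p 0) * (1 - p 3) - p 0 * p 3 * (1 - p 1) * (1 - p 2) < 0 := by
      have e1 : (1 - p 2) * ((p 1 - p 3) * (p 0 - p 1)) < 0 :=
        mul_neg_of_neg_of_pos (by linarith) (mul_pos_of_neg_of_neg (by linarith) (by linarith))
      have e2 : p 1 * ((1 - p 0) * (1 - p 3) - (1 - p 1) * (1 - p 2)) < 0 :=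
        mul_neg_of_pos_of_neg (by linarith) hB
      linarith
    have key : ∀ k, walls p k ≠ 0 ∧ negBit (walls p k) = baseSigns k := by
      have pos {a : ℝ} (h : 0 < a) : a ≠ 0 ∧ negBit a = false :=
        ⟨h.ne', negBit_eq_false.2 h.le⟩
      have neg {a : ℝ} (h : a < 0) : a ≠ 0 ∧ negBit a = true := ⟨h.ne, negBit_eq_true.2 h⟩
      rw [forall_fin15]
      exact ⟨pos (a := p 0) (by linarith), pos (a := p 1) (by linarith),
        pos (a := p 2) (by linarith), pos (a := p 3) (by linarith),
        neg (a := 1 - p 0) (by linarith), neg (a := 1 - p 1) (by linarith),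
        neg (a := 1 - p 2) (by linarith), neg (a := 1 - p 3) (by linarith),
        neg (sub_neg.2 h2), neg (sub_neg.2 hy3),
        neg (sub_neg.2 h1), neg (sub_neg.2 hz3),
        pos hA, neg hB, neg hQ⟩
    exact ⟨(mem_moduliY36_iff p).2 fun k => (key k).1, funext fun k => (key k).2⟩

theorem isConnected_signRegion_baseSigns : IsConnected (signRegion baseSigns) := by
  -- Walls 12 and 13 bound `w` below and above by functions of `x, y, z`. The fourth coordinate on
  -- the convex set `D` interpolates between these bounds.
  let D : Set (Fin 4 → ℝ) := {q | 1 < q 0 ∧ q 0 < q 1 ∧ q 0 < q 2 ∧ 0 < q 3 ∧ q 3 < 1}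
  let φ : (Fin 4 → ℝ) → Fin 4 → ℝ := fun q => ![q 0, q 1, q 2,
    (1 - q 3) * (q 1 * q 2 / q 0) + q 3 * (1 + (1 - q 1) * (1 - q 2) / (q 0 - 1))]
  have hD : Convex ℝ D := by
    rintro q ⟨q0, q1, q2, q3, q4⟩ r ⟨r0, r1, r2, r3, r4⟩ a b ha hb hab
    simp only [D, mem_ofPred_eq, Pi.add_apply, Pi.smul_apply, smul_eq_mul]
    obtain rfl : b = 1 - a := by linarith
    rcases ha.eq_or_lt with rfl | ha
    · simp [*]
    · refine ⟨?_, ?_, ?_, ?_, ?_⟩ <;> nlinarith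
  have hne : D.Nonempty := ⟨![2, 3, 3, 1 / 2], by simp [D]; norm_num⟩
  have hφ : ContinuousOn φ D := by
    refine continuousOn_vec4 (by fun_prop) (by fun_prop) (by fun_prop) ?_
    refine ContinuousOn.add (ContinuousOn.mul (by fun_prop) (ContinuousOn.div (by fun_prop)
      (by fun_prop) ?_)) (ContinuousOn.mul (by fun_prop) (ContinuousOn.add (by fun_prop)
      (ContinuousOn.div (by fun_prop) (by fun_prop) ?_)))
    · rintro q ⟨h, -⟩; linarith
    · rintro q ⟨h, -⟩; linarith
  have himage : signRegion baseSigns = φ '' D := by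
    ext p
    rw [mem_signRegion_baseSigns]
    constructor
    · rintro ⟨h0, h1, h2, hA, hB⟩
      have hx : 0 < p 0 := by linarith
      have hx1 : 0 < p 0 - 1 := by linarith
      have hl : p 1 * p 2 / p 0 < p 3 := by rw [div_lt_iff₀ hx]; linarith
      have hu : p 3 < 1 + (1 - p 1) * (1 - p 2) / (p 0 - 1) := by
        rw [← sub_lt_iff_lt_add', lt_div_iff₀ hx1]; linarith
      have hlu := sub_pos.2 (hl.trans hu)
      refine ⟨![p 0, p 1, p 2, (p 3 - p 1 * p 2 / p 0) /
        (1 + (1 - p 1) * (1 - p 2) / (p 0 - 1) - p 1 * p 2 / p 0)],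
        ⟨h0, h1, h2, div_pos (by linarith) hlu, (div_lt_one hlu).2 (by linarith)⟩, ?_⟩
      have h3 : ∀ l u t : ℝ, 0 < u - l →
          (1 - (t - l) / (u - l)) * l + (t - l) / (u - l) * u = t := by
        intro l u t h
        field_simp
        ring
      rw [← vec4_eta p]
      simp only [φ]
      congr 3
      simpa using h3 _ _ _ hlu
    · rintro ⟨q, ⟨h0, h1, h2, h3, h4⟩, rfl⟩
      have hx : 0 < q 0 := by linarith
      have hx1 : 0 < q 0 - 1 := by linarith
      have hgap : q 1 * q 2 / q 0 < 1 + (1 - q 1) * (1 - q 2) / (q 0 - 1) := by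
        rw [← sub_pos]
        -- The gap between the bounds factors, so the interval for `w` is never empty.
        have : 1 + (1 - q 1) * (1 - q 2) / (q 0 - 1) - q 1 * q 2 / q 0 =
            (q 1 - q 0) * (q 2 - q 0) / (q 0 * (q 0 - 1)) := by
          field_simp
          ring
        rw [this]
        exact div_pos (mul_pos (by linarith) (by linarith)) (mul_pos hx hx1)
      have hl : q 1 * q 2 / q 0 < φ q 3 := by simp [φ]; nlinarith
      have hu : φ q 3 < 1 + (1 - q 1) * (1 - q 2) / (q 0 - 1) := by simp [φ]; nlinarith
      rw [div_lt_iff₀ hx] at hl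
      rw [← sub_lt_iff_lt_add', lt_div_iff₀ hx1] at hu
      refine ⟨h0, h1, h2, ?_, ?_⟩
      · change 0 < q 0 * φ q 3 - q 1 * q 2
        linarith
      · change (1 - q 0) * (1 - φ q 3) - (1 - q 1) * (1 - q 2) < 0
        linarith
  rw [himage]
  exact ⟨hne.image φ, hD.isPreconnected.image φ hφ⟩

/-! ### Matching the two counts. -/

theorem onCodes_ofBits (f : (Fin 15 → Bool) → Fin 15 → Bool) (s : Fin 15 → Bool) :
    onCodes f (Nat.ofBits s) = Nat.ofBits (f s) := by
  unfold onCodes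
  congr 2
  funext k
  simp [Nat.testBit_ofBits_lt]

theorem exists_isConnected_of_mem_orbitCodes :
    ∀ n ∈ orbitCodes, ∃ s, Nat.ofBits s = n ∧ IsConnected (signRegion s) := by
  refine explore_induction _ _ ?_ _ _ _ _ ?_ (by simp)
  · rintro _ ⟨s, rfl, hs⟩ b hb
    simp only [neighbours, onCodes_ofBits, List.mem_cons, List.not_mem_nil, or_false] at hb
    rcases hb with rfl | rfl | rfl | rfl | rfl | rfl
    exacts [⟨_, rfl, isSignSymmetry_swap34.isConnected hs⟩,
      ⟨_, rfl, isSignSymmetry_swap12.isConnected hs⟩,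
      ⟨_, rfl, isSignSymmetry_swap56.isConnected hs⟩,
      ⟨_, rfl, isSignSymmetry_cremona.isConnected hs⟩,
      ⟨_, rfl, isSignSymmetry_swap45.isConnected hs⟩,
      ⟨_, rfl, isSignSymmetry_swap23.isConnected hs⟩]
  · intro a ha
    rw [List.mem_singleton.1 ha]
    exact ⟨baseSigns, rfl, isConnected_signRegion_baseSigns⟩

/-- The codes of the sign vectors allowed by the three-term relations are exactly those of the
orbit of the base chamber. -/
theorem toFinset_orbitCodes :
    orbitCodes.toFinset = validSigns.toFinset.image fun s => Nat.ofBits s := by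
  refine Finset.eq_of_subset_of_card_le ?_ ?_
  · intro n hn
    -- A code in the orbit is realized by a point, so its sign vector obeys the relations. Equal
    -- cardinalities then give the reverse inclusion.
    obtain ⟨s, rfl, ⟨p, hp, rfl⟩, -⟩ := exists_isConnected_of_mem_orbitCodes n (by simpa using hn)
    exact Finset.mem_image_of_mem _ (by simpa using signs_mem_validSigns hp)
  · rw [List.toFinset_card_of_nodup nodup_orbitCodes, length_orbitCodes, ← length_validSigns]
    exact Finset.card_image_le.trans (List.toFinset_card_le _)

theorem ofBits_injective : Function.Injective fun s : Fin 15 → Bool => Nat.ofBits s := by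
  intro s t h
  funext k
  have := congrArg (fun n => Nat.testBit n k) h
  simpa [Nat.testBit_ofBits_lt] using this

theorem isConnected_signRegion_signs {p : Fin 4 → ℝ} (hp : p ∈ moduliY36 ℝ) :
    IsConnected (signRegion (signs p)) := by
  have h : Nat.ofBits (signs p) ∈ orbitCodes.toFinset := by
    rw [toFinset_orbitCodes]
    exact Finset.mem_image_of_mem _ (by simpa using signs_mem_validSigns hp)
  obtain ⟨s, hs, hc⟩ := exists_isConnected_of_mem_orbitCodes _ (by simpa using h)
  rwa [← ofBits_injective hs]

/-! ### From sign vectors to connected components. -/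

theorem continuous_walls : Continuous walls := by
  refine continuous_pi (forall_fin15.2 ?_)
  simp only [walls, Matrix.cons_val]
  refine ⟨?_, ?_, ?_, ?_, ?_, ?_, ?_, ?_, ?_, ?_, ?_, ?_, ?_, ?_, ?_⟩ <;> fun_prop

theorem continuous_signs : Continuous fun p : moduliY36 ℝ => signs p := by
  refine continuous_pi fun k => (continuous_bool_rng true).2 ?_
  have hk : Continuous fun p : moduliY36 ℝ => walls p k :=
    (continuous_apply k).comp (continuous_walls.comp continuous_subtype_val)
  have h1 : (fun p : moduliY36 ℝ => signs p k) ⁻¹' {true} =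
      {p : moduliY36 ℝ | walls p k < 0} := by
    ext p; exact negBit_eq_true
  -- No wall vanishes on the space, so negativity is both an open and a closed condition.
  have h2 : {p : moduliY36 ℝ | walls p k < 0} =
      {p : moduliY36 ℝ | walls p k ≤ 0} := by
    ext p
    exact ((mem_moduliY36_iff _).1 p.2 k).le_iff_lt.symm
  rw [h1]
  exact ⟨h2 ▸ isClosed_le hk continuous_const, isOpen_lt hk continuous_const⟩

/-- The number of connected components equals the number of values of a locally constant function
with preconnected fibres. -/
theorem card_connectedComponents_eq {X α : Type*} [TopologicalSpace X] [TopologicalSpace α]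
    [DiscreteTopology α] {f : X → α} (hf : Continuous f)
    (hpre : ∀ x, IsPreconnected (f ⁻¹' {f x})) :
    Nat.card (ConnectedComponents X) = Nat.card (range f) := by
  have hinj : Function.Injective hf.connectedComponentsLift := by
    intro a b
    obtain ⟨x, rfl⟩ := ConnectedComponents.surjective_coe a
    obtain ⟨y, rfl⟩ := ConnectedComponents.surjective_coe b
    intro h
    simp only [Continuous.connectedComponentsLift_apply_coe] at h
    refine ConnectedComponents.coe_eq_coe'.2 ?_
    exact (hpre y).subset_connectedComponent rfl h
  have hrange : range hf.connectedComponentsLift = range f := by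
    rw [← ConnectedComponents.surjective_coe.range_comp, hf.connectedComponentsLift_comp_coe]
  rw [← hrange]
  exact Nat.card_congr (Equiv.ofInjective _ hinj)

theorem corollary9p3 : Nat.card (ConnectedComponents (moduliY36 ℝ)) = 432 := by
  rw [card_connectedComponents_eq continuous_signs]
  · have hr : (fun s : Fin 15 → Bool => Nat.ofBits s) ''
        range (fun p : moduliY36 ℝ => signs p) = orbitCodes.toFinset := by
      ext n
      constructor
      · rintro ⟨_, ⟨p, rfl⟩, rfl⟩
        rw [toFinset_orbitCodes]
        exact Finset.mem_coe.2
          (Finset.mem_image_of_mem _ (by simpa using signs_mem_validSigns p.2))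
      · intro hn
        obtain ⟨s, rfl, ⟨p, hp, rfl⟩, -⟩ := exists_isConnected_of_mem_orbitCodes n (by simpa using hn)
        exact ⟨_, ⟨⟨p, hp⟩, rfl⟩, rfl⟩
    rw [← Nat.card_image_of_injective ofBits_injective, hr, Nat.card_coe_set_eq,
      Set.ncard_coe_finset, List.toFinset_card_of_nodup nodup_orbitCodes, length_orbitCodes]
  · intro p
    have h := (isConnected_signRegion_signs p.2).isPreconnected
    refine Topology.IsInducing.subtypeVal.isPreconnected_image.1 ?_
    convert h using 1
    ext q
    constructor
    · rintro ⟨q, hq, rfl⟩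
      exact ⟨q.2, hq⟩
    · rintro ⟨hq, hs⟩
      exact ⟨⟨q, hq⟩, hs, rfl⟩
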